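/- Let $0<\lambda<\mu<1$ and let $$T_0(x,y)=(\lambda x,\mu y),\qquad T_1(x,y)=(\mu x+1-\mu,\ \lambda y+1-\lambda)$$ on $\mathbb R^2$. Let $A_{\lambda,\mu}$ be the attractor of the iterated function system $\{T_0,T_1\}$, that is, the unique non-empty compact set $A\subset\mathbb R^2$ with $A=T_0(A)\cup T_1(A)$. If $\lambda\mu\ge 2^{-1/6}$, then $A_{\lambda,\mu}$ has non-empty interior. -/

import Mathlib

open scoped NNReal ENNReal

namespace SelfAffine

/-- The map `(x, y) ↦ (lam * x, mu * y)`. -/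
def T₀ (lam mu : ℝ) (p : ℝ × ℝ) : ℝ × ℝ :=
  (lam * p.1, mu * p.2)

/-- The map `(x, y) ↦ (mu * x + 1 - mu, lam * y + 1 - lam)`. -/
def T₁ (lam mu : ℝ) (p : ℝ × ℝ) : ℝ × ℝ :=
  (mu * p.1 + 1 - mu, lam * p.2 + 1 - lam)

/-- `A` is the attractor of the iterated function system `{f, g}`: a non-empty compact set
with `A = f(A) ∪ g(A)`. For contractions `f`, `g` of a complete space there is exactly one. -/
structure IsAttractor {X : Type*} [TopologicalSpace X] (f g : X → X) (A : Set X) : Prop where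
  nonempty : A.Nonempty
  isCompact : IsCompact A
  eq_union : A = f '' A ∪ g '' A

theorem lipschitzWith_T₀ {lam mu : ℝ} (h0 : 0 < lam) (h1 : lam < mu) :
    LipschitzWith mu.toNNReal (T₀ lam mu) := by
  refine LipschitzWith.of_dist_le_mul fun p q => ?_
  rw [Real.coe_toNNReal _ (h0.trans h1).le, Prod.dist_eq, Prod.dist_eq, Real.dist_eq, Real.dist_eq,
    Real.dist_eq, Real.dist_eq]
  simp only [T₀, ← mul_sub, abs_mul, abs_of_pos h0, abs_of_pos (h0.trans h1)]
  refine max_le ?_ ?_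
  · exact mul_le_mul h1.le (le_max_left _ _) (abs_nonneg _) (h0.trans h1).le
  · exact mul_le_mul_of_nonneg_left (le_max_right _ _) (h0.trans h1).le

theorem lipschitzWith_T₁ {lam mu : ℝ} (h0 : 0 < lam) (h1 : lam < mu) :
    LipschitzWith mu.toNNReal (T₁ lam mu) := by
  refine LipschitzWith.of_dist_le_mul fun p q => ?_
  rw [Real.coe_toNNReal _ (h0.trans h1).le, Prod.dist_eq, Prod.dist_eq, Real.dist_eq, Real.dist_eq,
    Real.dist_eq, Real.dist_eq]
  have e (a x y : ℝ) : a * x + 1 - a - (a * y + 1 - a) = a * (x - y) := by ring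
  simp only [T₁, e, abs_mul, abs_of_pos h0, abs_of_pos (h0.trans h1)]
  refine max_le ?_ ?_
  · exact mul_le_mul_of_nonneg_left (le_max_left _ _) (h0.trans h1).le
  · exact mul_le_mul h1.le (le_max_right _ _) (abs_nonneg _) (h0.trans h1).le

theorem hausdorffEDist_image_le {X : Type*} [PseudoEMetricSpace X] {f : X → X} {K : ℝ≥0}
    (hf : LipschitzWith K f) {s t : Set X} (hs : IsCompact s) (ht : IsCompact t)
    (hs' : s.Nonempty) (ht' : t.Nonempty) :
    Metric.hausdorffEDist (f '' s) (f '' t) ≤ K * Metric.hausdorffEDist s t := by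
  refine Metric.hausdorffEDist_le_of_mem_edist ?_ ?_
  · rintro _ ⟨x, hx, rfl⟩
    obtain ⟨y, hy, hxy⟩ := ht.exists_infEDist_eq_edist ht' x
    refine ⟨f y, ⟨y, hy, rfl⟩, (hf x y).trans ?_⟩
    rw [← hxy]
    gcongr
    exact Metric.infEDist_le_hausdorffEDist_of_mem hx
  · rintro _ ⟨x, hx, rfl⟩
    obtain ⟨y, hy, hxy⟩ := hs.exists_infEDist_eq_edist hs' x
    refine ⟨f y, ⟨y, hy, rfl⟩, (hf x y).trans ?_⟩
    rw [← hxy, Metric.hausdorffEDist_comm]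
    gcongr
    exact Metric.infEDist_le_hausdorffEDist_of_mem hx

/-- Two contractions of a complete space have exactly one attractor. -/
theorem existsUnique_isAttractor {X : Type*} [MetricSpace X] [CompleteSpace X] [Nonempty X]
    {f g : X → X} {K : ℝ≥0} (hK : K < 1) (hf : LipschitzWith K f) (hg : LipschitzWith K g) :
    ∃! A : Set X, IsAttractor f g A := by
  let F : TopologicalSpace.NonemptyCompacts X → TopologicalSpace.NonemptyCompacts X :=
    fun A => A.map f hf.continuous ⊔ A.map g hg.continuous
  have hF : ContractingWith K F := by
    refine ⟨hK, fun A B => ?_⟩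
    change Metric.hausdorffEDist (f '' (A : Set X) ∪ g '' A) (f '' (B : Set X) ∪ g '' B) ≤
      K * Metric.hausdorffEDist (A : Set X) B
    exact Metric.hausdorffEDist_union_le.trans (max_le
      (hausdorffEDist_image_le hf A.isCompact B.isCompact A.nonempty B.nonempty)
      (hausdorffEDist_image_le hg A.isCompact B.isCompact A.nonempty B.nonempty))
  have : Nonempty (TopologicalSpace.NonemptyCompacts X) := ⟨{Classical.arbitrary X}⟩
  let A₀ := ContractingWith.fixedPoint F hF
  have hA₀ : F A₀ = A₀ := hF.fixedPoint_isFixedPt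
  refine ⟨A₀, ⟨A₀.nonempty, A₀.isCompact, ?_⟩, ?_⟩
  · exact (congrArg (fun B : TopologicalSpace.NonemptyCompacts X => (B : Set X)) hA₀).symm
  · intro B hB
    let B' : TopologicalSpace.NonemptyCompacts X := ⟨⟨B, hB.isCompact⟩, hB.nonempty⟩
    have hB' : F B' = B' := TopologicalSpace.NonemptyCompacts.ext hB.eq_union.symm
    have h := hF.fixedPoint_unique (x := B') hB'
    exact congrArg (fun C : TopologicalSpace.NonemptyCompacts X => (C : Set X)) h

/-- For `0 < lam < mu < 1` the system `{T₀, T₁}` has exactly one attractor. -/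
theorem existsUnique_attractor {lam mu : ℝ} (h0 : 0 < lam) (h1 : lam < mu) (h2 : mu < 1) :
    ∃! A : Set (ℝ × ℝ), IsAttractor (T₀ lam mu) (T₁ lam mu) A :=
  existsUnique_isAttractor (Real.toNNReal_lt_one.2 h2) (lipschitzWith_T₀ h0 h1)
    (lipschitzWith_T₁ h0 h1)

end SelfAffine

/-!
Write `ρ = lam * mu` and `α = (1 - lam) * (1 - mu)`. A composition of `T₀`s and `T₁`s in which both
maps occur `n` times is a homothety of ratio `ρ ^ n`, and `T₁ ∘ T₀` differs from `T₀ ∘ T₁` by the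
constant vector `α (1, 1)`. In the composition `W i ∘ T₀ ∘ W j ∘ T₁`, where each of `W i`, `W j` is
either `T₀ ∘ T₁` or `T₁ ∘ T₀`, the choice of `W i` therefore moves the result by `α (1, 1)`, and the
choice of `W j` moves it by `ρ` times the image of `α (1, 1)` under the linear part of `T₀`, that is,
by `ρ α (lam, mu)`. The two vectors are independent because `lam < mu`. These four compositions are
thus homotheties of ratio `ρ ^ 3` whose translation parts are the corners of a parallelogram. As
`ρ ^ 3 ≥ 1 / 2`, the images of a suitable parallelogram `P` under them cover `P`
(`exists_digit_expansion`, `balancedMap_apply`). The attractor `A` is closed and mapped into itself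
by these contractions, so it contains `P` (`subset_of_covered_by_contractions`).
-/

namespace SelfAffine

open Set

/-- If the images of a bounded set `P` under `K`-Lipschitz maps, `K < 1`, cover `P`, and these maps
send a nonempty closed set `A` into itself, then `P ⊆ A`. -/
theorem subset_of_covered_by_contractions {X : Type*} [PseudoMetricSpace X] {A P : Set X}
    {K : ℝ≥0} (hK : K < 1) (hA : IsClosed A) (hne : A.Nonempty) (hP : Bornology.IsBounded P)
    (hcov : ∀ z ∈ P, ∃ F : X → X, LipschitzWith K F ∧ MapsTo F A A ∧ ∃ w ∈ P, F w = z) :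
    P ⊆ A := by
  obtain ⟨a, ha⟩ := hne
  obtain ⟨C, hC⟩ := hP.subset_closedBall a
  have key (n : ℕ) : ∀ z ∈ P, Metric.infDist z A ≤ (K : ℝ) ^ n * C := by
    induction n with
    | zero =>
      intro z hz
      simpa using (Metric.infDist_le_dist_of_mem ha).trans (Metric.mem_closedBall.1 (hC hz))
    | succ n ih =>
      intro z hz
      obtain ⟨F, hF, hFA, w, hw, rfl⟩ := hcov z hz
      have hle : Metric.infDist (F w) A ≤ K * Metric.infDist w A := by
        refine le_of_forall_pos_le_add fun ε hε => ?_
        obtain ⟨y, hy, hwy⟩ := (Metric.infDist_lt_iff ⟨a, ha⟩).1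
          (lt_add_of_pos_right (Metric.infDist w A) hε)
        have hK' : (K : ℝ) ≤ 1 := by exact_mod_cast hK.le
        calc Metric.infDist (F w) A ≤ dist (F w) (F y) := Metric.infDist_le_dist_of_mem (hFA hy)
          _ ≤ K * dist w y := hF.dist_le_mul w y
          _ ≤ K * (Metric.infDist w A + ε) := by gcongr
          _ ≤ K * Metric.infDist w A + ε := by nlinarith
      calc Metric.infDist (F w) A ≤ K * Metric.infDist w A := hle
        _ ≤ K * ((K : ℝ) ^ n * C) := by gcongr; exact ih w hw
        _ = (K : ℝ) ^ (n + 1) * C := by ring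
  intro z hz
  have hlim : Filter.Tendsto (fun n : ℕ => (K : ℝ) ^ n * C) Filter.atTop (nhds 0) := by
    simpa using (tendsto_pow_atTop_nhds_zero_of_lt_one K.coe_nonneg
      (by exact_mod_cast hK)).mul_const C
  have h0 : Metric.infDist z A ≤ 0 := ge_of_tendsto' hlim fun n => key n z hz
  exact (hA.mem_iff_infDist_zero ⟨a, ha⟩).2 (le_antisymm h0 Metric.infDist_nonneg)

/-- For `1 / 2 ≤ r < 1` the interval `[0, a / (1 - r)]` is covered by its images under
`s ↦ r * s` and `s ↦ r * s + a`. -/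
theorem exists_digit_expansion {r a s : ℝ} (hr : 1 / 2 ≤ r) (hr1 : r < 1) (ha : 0 ≤ a)
    (hs : s ∈ Icc 0 (a / (1 - r))) :
    ∃ b : Bool, ∃ t ∈ Icc 0 (a / (1 - r)), r * t + b.toNat * a = s := by
  have hr0 : 0 < r := by linarith
  have hS : r * (a / (1 - r)) + a = a / (1 - r) := by
    have : 1 - r ≠ 0 := by linarith
    field_simp
    ring
  have hS0 : 0 ≤ a / (1 - r) := div_nonneg ha (by linarith)
  generalize a / (1 - r) = S at *
  obtain ⟨hs0, hs1⟩ := hs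
  by_cases hle : s ≤ r * S
  · refine ⟨false, s / r, ⟨by positivity, (div_le_iff₀' hr0).2 hle⟩, ?_⟩
    simp [mul_div_cancel₀ _ hr0.ne']
  · -- `a ≤ r * S < s` because `a = (1 - r) * S` and `1 - r ≤ r`.
    refine ⟨true, (s - a) / r, ⟨div_nonneg (by nlinarith) hr0.le,
      (div_le_iff₀' hr0).2 (by linarith)⟩, ?_⟩
    simp [mul_div_cancel₀ _ hr0.ne']

/-- The composition of `T₀` and `T₁` in one of the two orders: `T₁ ∘ T₀` for `true`, `T₀ ∘ T₁` for
`false`. -/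
def pairMap (lam mu : ℝ) : Bool → ℝ × ℝ → ℝ × ℝ
  | true => T₁ lam mu ∘ T₀ lam mu
  | false => T₀ lam mu ∘ T₁ lam mu

/-- The composition `pairMap i ∘ T₀ ∘ pairMap j ∘ T₁`, a homothety of ratio `(lam * mu) ^ 3`. -/
def balancedMap (lam mu : ℝ) (i j : Bool) : ℝ × ℝ → ℝ × ℝ :=
  pairMap lam mu i ∘ T₀ lam mu ∘ pairMap lam mu j ∘ T₁ lam mu

theorem pairMap_apply (lam mu : ℝ) (b : Bool) (p : ℝ × ℝ) :
    pairMap lam mu b p =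
      (lam * mu * p.1 + lam * (1 - mu) + b.toNat * ((1 - lam) * (1 - mu)),
        lam * mu * p.2 + mu * (1 - lam) + b.toNat * ((1 - lam) * (1 - mu))) := by
  cases b <;> ext <;> simp [pairMap, T₀, T₁] <;> ring

/-- The action of `balancedMap` in the coordinates with axes `(1, 1)` and `(lam, mu)` and origin at
the fixed point `c` of `balancedMap lam mu false false`. -/
theorem balancedMap_apply {lam mu : ℝ} {c : ℝ × ℝ} (hc : balancedMap lam mu false false c = c)
    (i j : Bool) (s t : ℝ) :
    balancedMap lam mu i j (c.1 + s + t * lam, c.2 + s + t * mu) =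
      (c.1 + ((lam * mu) ^ 3 * s + i.toNat * ((1 - lam) * (1 - mu))) +
          ((lam * mu) ^ 3 * t + j.toNat * (lam * mu * ((1 - lam) * (1 - mu)))) * lam,
        c.2 + ((lam * mu) ^ 3 * s + i.toNat * ((1 - lam) * (1 - mu))) +
          ((lam * mu) ^ 3 * t + j.toNat * (lam * mu * ((1 - lam) * (1 - mu)))) * mu) := by
  simp only [balancedMap, Function.comp_apply, pairMap_apply, T₀, T₁, Prod.ext_iff,
    Bool.toNat_false, Nat.cast_zero] at hc ⊢
  exact ⟨by linear_combination hc.1, by linear_combination hc.2⟩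

theorem lipschitzWith_pairMap {lam mu : ℝ} (h0 : 0 < lam) (h1 : lam < mu) (b : Bool) :
    LipschitzWith (mu.toNNReal * mu.toNNReal) (pairMap lam mu b) := by
  cases b
  · exact (lipschitzWith_T₀ h0 h1).comp (lipschitzWith_T₁ h0 h1)
  · exact (lipschitzWith_T₁ h0 h1).comp (lipschitzWith_T₀ h0 h1)

theorem lipschitzWith_balancedMap {lam mu : ℝ} (h0 : 0 < lam) (h1 : lam < mu) (i j : Bool) :
    LipschitzWith (mu.toNNReal ^ 6) (balancedMap lam mu i j) := by
  have e : mu.toNNReal ^ 6 = mu.toNNReal * mu.toNNReal *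
      (mu.toNNReal * (mu.toNNReal * mu.toNNReal * mu.toNNReal)) := by ring
  rw [e]
  exact (lipschitzWith_pairMap h0 h1 i).comp ((lipschitzWith_T₀ h0 h1).comp
    ((lipschitzWith_pairMap h0 h1 j).comp (lipschitzWith_T₁ h0 h1)))

theorem mapsTo_balancedMap {lam mu : ℝ} {A : Set (ℝ × ℝ)} (h0 : MapsTo (T₀ lam mu) A A)
    (h1 : MapsTo (T₁ lam mu) A A) (i j : Bool) : MapsTo (balancedMap lam mu i j) A A := by
  have hp (b : Bool) : MapsTo (pairMap lam mu b) A A := by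
    cases b
    · exact h0.comp h1
    · exact h1.comp h0
  exact (hp i).comp (h0.comp ((hp j).comp h1))

/-- A set that contains the parallelogram with corner `c` and sides `S • (1, 1)` and
`T • (lam, mu)` has an interior point. -/
theorem interior_nonempty_of_parallelogram_subset {lam mu S T : ℝ} (h : lam < mu) (hS : 0 < S)
    (hT : 0 < T) {c : ℝ × ℝ} {A : Set (ℝ × ℝ)}
    (hA : ∀ s ∈ Icc 0 S, ∀ t ∈ Icc 0 T, (c.1 + s + t * lam, c.2 + s + t * mu) ∈ A) :
    (interior A).Nonempty := by
  have hd : mu - lam ≠ 0 := (sub_pos.2 h).ne'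
  -- The coordinates of a point with respect to the origin `c` and the axes `(1, 1)`, `(lam, mu)`.
  let t : ℝ × ℝ → ℝ := fun p => ((p.2 - c.2) - (p.1 - c.1)) / (mu - lam)
  let s : ℝ × ℝ → ℝ := fun p => p.1 - c.1 - t p * lam
  have ht : Continuous t := by fun_prop
  have hs : Continuous s := by fun_prop
  have hcoord (p : ℝ × ℝ) : (c.1 + s p + t p * lam, c.2 + s p + t p * mu) = p := by
    have e : t p * (mu - lam) = (p.2 - c.2) - (p.1 - c.1) := div_mul_cancel₀ _ hd
    ext
    · simp only [s]; ring
    · simp only [s]; linear_combination e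
  have hopen : IsOpen (s ⁻¹' Ioo 0 S ∩ t ⁻¹' Ioo 0 T) :=
    (isOpen_Ioo.preimage hs).inter (isOpen_Ioo.preimage ht)
  have hsub : s ⁻¹' Ioo 0 S ∩ t ⁻¹' Ioo 0 T ⊆ A := fun p hp => by
    rw [← hcoord p]
    exact hA _ (Ioo_subset_Icc_self hp.1) _ (Ioo_subset_Icc_self hp.2)
  refine ⟨(c.1 + S / 2 + T / 2 * lam, c.2 + S / 2 + T / 2 * mu), interior_maximal hsub hopen ?_⟩
  have e1 : t (c.1 + S / 2 + T / 2 * lam, c.2 + S / 2 + T / 2 * mu) = T / 2 := by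
    simp only [t]
    field_simp
    ring
  have e2 : s (c.1 + S / 2 + T / 2 * lam, c.2 + S / 2 + T / 2 * mu) = S / 2 := by
    simp only [s, e1]
    ring
  simp only [mem_inter_iff, mem_preimage, e1, e2, mem_Ioo]
  exact ⟨⟨by linarith, by linarith⟩, ⟨by linarith, by linarith⟩⟩

theorem half_le_pow_three {r : ℝ} (h : (2 : ℝ) ^ (-(1 / 6) : ℝ) ≤ r) (hr : r < 1) :
    1 / 2 ≤ r ^ 3 := by
  have h0 : (0 : ℝ) ≤ 2 ^ (-(1 / 6) : ℝ) := by positivity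
  have e : ((2 : ℝ) ^ (-(1 / 6) : ℝ)) ^ 6 = 1 / 2 := by
    rw [← Real.rpow_natCast, ← Real.rpow_mul (by norm_num)]
    norm_num [Real.rpow_neg_one]
  calc 1 / 2 = ((2 : ℝ) ^ (-(1 / 6) : ℝ)) ^ 6 := e.symm
    _ ≤ r ^ 6 := by gcongr
    _ ≤ r ^ 3 := pow_le_pow_of_le_one (h0.trans h) hr.le (by norm_num)

end SelfAffine

open SelfAffine in
theorem theorem3 (lam mu : ℝ) (h0 : 0 < lam) (h1 : lam < mu) (h2 : mu < 1)
    (h : (2 : ℝ) ^ (-(1 / 6) : ℝ) ≤ lam * mu)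
    (A : Set (ℝ × ℝ)) (hA : SelfAffine.IsAttractor (SelfAffine.T₀ lam mu) (SelfAffine.T₁ lam mu) A) :
    (interior A).Nonempty := by
  have hmu : 0 < mu := h0.trans h1
  have hρ : 0 < lam * mu := mul_pos h0 hmu
  have hρ1 : lam * mu < 1 := by nlinarith
  have hr1 : (lam * mu) ^ 3 < 1 := pow_lt_one₀ hρ.le hρ1 (by norm_num)
  have hr := half_le_pow_three h hρ1
  have hα : 0 < (1 - lam) * (1 - mu) := mul_pos (by linarith) (by linarith)
  have hA0 : Set.MapsTo (T₀ lam mu) A A := fun p hp => by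
    rw [hA.eq_union]; exact Or.inl ⟨p, hp, rfl⟩
  have hA1 : Set.MapsTo (T₁ lam mu) A A := fun p hp => by
    rw [hA.eq_union]; exact Or.inr ⟨p, hp, rfl⟩
  have hK : mu.toNNReal ^ 6 < 1 := pow_lt_one₀ zero_le (Real.toNNReal_lt_one.2 h2) (by norm_num)
  obtain ⟨c, hc⟩ : ∃ c, balancedMap lam mu false false c = c :=
    have hF : ContractingWith (mu.toNNReal ^ 6) (balancedMap lam mu false false) :=
      ⟨hK, lipschitzWith_balancedMap h0 h1 false false⟩
    ⟨hF.fixedPoint, hF.fixedPoint_isFixedPt⟩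
  let S : ℝ := (1 - lam) * (1 - mu) / (1 - (lam * mu) ^ 3)
  let T : ℝ := lam * mu * ((1 - lam) * (1 - mu)) / (1 - (lam * mu) ^ 3)
  let φ : ℝ × ℝ → ℝ × ℝ := fun q => (c.1 + q.1 + q.2 * lam, c.2 + q.1 + q.2 * mu)
  have hPA : φ '' (Set.Icc 0 S ×ˢ Set.Icc 0 T) ⊆ A := by
    refine subset_of_covered_by_contractions hK hA.isCompact.isClosed hA.nonempty
      ((isCompact_Icc.prod isCompact_Icc).image (by fun_prop)).isBounded ?_
    rintro _ ⟨⟨s, t⟩, ⟨hs, ht⟩, rfl⟩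
    obtain ⟨i, s', hs', rfl⟩ := exists_digit_expansion hr hr1 hα.le hs
    obtain ⟨j, t', ht', rfl⟩ := exists_digit_expansion hr hr1 (mul_pos hρ hα).le ht
    exact ⟨balancedMap lam mu i j, lipschitzWith_balancedMap h0 h1 i j,
      mapsTo_balancedMap hA0 hA1 i j, φ (s', t'), ⟨(s', t'), ⟨hs', ht'⟩, rfl⟩,
      balancedMap_apply hc i j s' t'⟩
  exact interior_nonempty_of_parallelogram_subset (c := c) h1
    (div_pos hα (by linarith) : 0 < S) (div_pos (mul_pos hρ hα) (by linarith) : 0 < T)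
    fun s hs t ht => hPA ⟨(s, t), ⟨hs, ht⟩, rfl⟩
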